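/- **Theorem (CDF of the harvested power, MISO).** Let $L\ge 1$, let $a_1,\dots,a_L$ be positive integers, and let $b_i,l_i,p_i>0$ ($1\le i\le L$) and $P_s,A,B>0$ be real numbers. Let $h_1,\dots,h_L$ be complex random fading coefficients such that $|h_1|,\dots,|h_L|$ are independent and $|h_i|$ has the Nakagami distribution with shape $a_i$ and spread $a_i/b_i$, i.e. density $$\frac{2\,b_i^{a_i}}{\Gamma(a_i)}\,x^{2a_i-1}e^{-b_i x^2},\qquad x\ge 0.$$ Let the harvested power be $$Q^M=\frac{P_s\left(1+e^{AB}\right)}{e^{AB}\left(1+e^{-A\left(\sum_{i=1}^L l_ip_i|h_i|^2-B\right)}\right)}-\frac{P_s}{e^{AB}},$$ and put $\beta_i=\frac{b_i}{l_ip_i}$, $sa_L=\sum_{i=1}^L a_i$, $\gamma(s,x)=\int_0^x t^{s-1}e^{-t}\,dt$ and, for $0\le q<P_s$, $$\Lambda(q)=\ln\left(\frac{P_s\left(1+e^{AB}\right)}{e^{AB}\left(q+\frac{P_s}{e^{AB}}\right)}-1\right)-AB .$$ For $1\le i\le L$ and $1\le k\le a_i$ let $$\Xi_L^0(i,k)=(-1)^{sa_L-a_i}\,\frac{\prod_{w=1}^L\beta_w^{a_w}}{\beta_i^{k}}\sum_{a_i=j_0\ge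 j_1\ge\cdots\ge j_{L-2}\ge j_{L-1}=k}\ \prod_{s=0}^{L-2}\frac{\left(j_s+a_{\sigma(s)}-j_{s+1}-1\right)!}{\left(a_{\sigma(s)}-1\right)!\,\left(j_s-j_{s+1}\right)!}\left(\beta_i-\beta_{\sigma(s)}\right)^{j_{s+1}-j_s-a_{\sigma(s)}},$$ where $\sigma(0)<\dots<\sigma(L-2)$ are the elements of $\{1,\dots,L\}\setminus\{i\}$, and the sum runs over integers $j_1,\dots,j_{L-2}$, the end points $j_0=a_i$ and $j_{L-1}=k$ being fixed. (For $L=1$ the product is empty, and the sum is $1$ if $k=a_1$ and $0$ otherwise.) Then the received power $\sum_{i=1}^L l_ip_i|h_i|^2$ is a sum of independent random variables $l_ip_i|h_i|^2$, the $i$-th of which is gamma distributed with shape $a_i$ and rate $\beta_i$. The CDF $F_{Q^M}(q)=P(Q^M\le q)$ is $0$ for $q<0$ and $1$ for $q\ge P_s$, and for $0\le q<P_s$ it is as follows. 1. If $\beta_1=\dots=\beta_L$, then, for every $i$, $$F_{Q^M}(q)=\frac{1}{\Gamma(sa_L)}\,\gamma\left(sa_L,\,-\frac{b_i}{A\,l_ip_i}\Lambda(q)\right).$$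 2. If $\beta_i\ne\beta_j$ for all $i\neq j$, then $$F_{Q^M}(q)=\sum_{i=1}^{L}\sum_{k=1}^{a_i}\frac{1}{\Gamma(k)}\,\gamma\left(k,\,-\frac{b_i}{A\,l_ip_i}\Lambda(q)\right)\Xi_L^0(i,k).$$ -/

import Mathlib

open MeasureTheory ProbabilityTheory

namespace MISO

noncomputable section

/-- Density of the Nakagami distribution with shape `m` and spread `w` (the mean square). -/
def nakagamiPDFReal (m w x : ℝ) : ℝ :=
  if 0 ≤ x then
    2 * m ^ m / (Real.Gamma m * w ^ m) * x ^ (2 * m - 1) * Real.exp (-(m / w) * x ^ 2)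
  else 0

/-- The Nakagami distribution with shape `m` and spread `w`, as a measure on the real line. -/
def nakagamiMeasure (m w : ℝ) : Measure ℝ :=
  volume.withDensity fun x => ENNReal.ofReal (nakagamiPDFReal m w x)

/-- The lower incomplete gamma function `γ(s, x) = ∫₀ˣ t ^ (s - 1) e ^ (-t) dt`. -/
def lowerGamma (s x : ℝ) : ℝ :=
  ∫ t in (0 : ℝ)..x, t ^ (s - 1) * Real.exp (-t)

/-- The received power `∑ i, l i * p i * |h i| ^ 2` from `L` antennas with path losses `l`,
transmitted powers `p` and fading coefficients `h`. -/
def receivedPower {L : ℕ} (l p : Fin L → ℝ) (h : Fin L → ℂ) : ℝ :=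
  ∑ i, l i * p i * ‖h i‖ ^ 2

/-- The power harvested by the nonlinear (logistic) circuit from the input power `x`, with
saturation level `Ps` and circuit constants `A`, `B`. -/
def harvestedPower (Ps A B x : ℝ) : ℝ :=
  Ps * (1 + Real.exp (A * B)) / (Real.exp (A * B) * (1 + Real.exp (-A * (x - B))))
    - Ps / Real.exp (A * B)

/-- `ln (Ps (1 + e^{AB}) / (e^{AB} (q + Ps / e^{AB})) - 1) - A B`. -/
def logTerm (Ps A B q : ℝ) : ℝ :=
  Real.log (Ps * (1 + Real.exp (A * B)) /
    (Real.exp (A * B) * (q + Ps / Real.exp (A * B))) - 1) - A * B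

/-- The index set of the nested sum in the weights for `L = n + 1` summands: all chains
`a = j₀ ≥ j₁ ≥ ⋯ ≥ j_{L-2} ≥ j_{L-1} = k`. The inner entries `j₁, …, j_{L-2}` are the summation
variables, the end points are fixed. -/
def chains (n a k : ℕ) : Finset (Fin (n + 1) → ℕ) :=
  open Classical in
  (Fintype.piFinset fun _ : Fin (n + 1) => Finset.Icc k a).filter
    fun j => Antitone j ∧ j 0 = a ∧ j (Fin.last n) = k

/-- The weight `Ξ⁰_L(i, k, {a_q}, {β_q})` for `L = n + 1`. With `j₀ = a i` and `j_{L-1} = k`, the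
first, the last and the intermediate factors of the closed formula all have the same shape. The
index `i.succAbove s` runs through all indices other than `i` in increasing order. -/
def Xi {n : ℕ} (i : Fin (n + 1)) (k : ℕ) (a : Fin (n + 1) → ℕ) (β : Fin (n + 1) → ℝ) : ℝ :=
  ∑ j ∈ chains n (a i) k,
    (-1 : ℝ) ^ ((∑ w, a w) - a i) * ((∏ w, β w ^ a w) / β i ^ k) *
      ∏ s : Fin n,
        ((Nat.factorial (j s.castSucc + a (i.succAbove s) - j s.succ - 1) : ℝ) /
            ((Nat.factorial (a (i.succAbove s) - 1) : ℝ) *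
              (Nat.factorial (j s.castSucc - j s.succ) : ℝ))) *
          (β i - β (i.succAbove s)) ^
            ((j s.succ : ℤ) - (j s.castSucc : ℤ) - (a (i.succAbove s) : ℤ))

end

end MISO

/-!
Scaling and squaring turns a Nakagami variable into a gamma variable, so the received power is a
sum of independent gamma variables and its characteristic function at `t` is
`∏ w, (β w / (β w - i t)) ^ a w`. If all rates agree, this is again the characteristic function of
a gamma distribution. If they are pairwise distinct, partial fractions in `-i t` write the product
as a linear combination of the functions `(β i / (β i - i t)) ^ k`, so the law of the received power
is the same signed combination of gamma distributions. The coefficients are Taylor coefficients at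
`-β i` of the reciprocal of the product of the factors belonging to the other indices; each such
reciprocal is a product of negative binomial series, and the coefficient of a product of power
series is a sum over chains of exponents: this is the nested sum in `Xi`. Finally the harvested
power is an increasing function of the received power, so its distribution function at `q` is that
of the received power at the preimage `-Λ(q) / A` of `q`.
-/

namespace MISO

section Chains

open Finset

open scoped PowerSeries

lemma mem_chains {n a k : ℕ} {j : Fin (n + 1) → ℕ} :
    j ∈ chains n a k ↔ Antitone j ∧ j 0 = a ∧ j (Fin.last n) = k := by
  simp only [chains, mem_filter, Fintype.mem_piFinset, mem_Icc, and_iff_right_iff_imp]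
  rintro ⟨hj, rfl, rfl⟩ s
  exact ⟨hj (Fin.le_last s), hj (Fin.zero_le s)⟩

lemma cons_mem_chains {n a k c : ℕ} {j : Fin (n + 1) → ℕ} :
    (Fin.cons c j : Fin (n + 2) → ℕ) ∈ chains (n + 1) a k ↔
      c = a ∧ j 0 ∈ Icc k a ∧ j ∈ chains n (j 0) k := by
  have hcons : Antitone (Fin.cons c j : Fin (n + 2) → ℕ) ↔ j 0 ≤ c ∧ Antitone j := by
    simp only [Fin.antitone_iff_succ_le, Fin.forall_fin_succ (n := n), Fin.cons_succ,
      Fin.castSucc_zero, Fin.cons_zero, ← Fin.succ_castSucc]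
  simp only [mem_chains, hcons, Fin.cons_zero, ← Fin.succ_last, Fin.cons_succ, mem_Icc, true_and]
  constructor
  · rintro ⟨⟨h0, hj⟩, rfl, hk⟩
    exact ⟨rfl, ⟨hk ▸ hj (Fin.zero_le _), h0⟩, hj, hk⟩
  · rintro ⟨rfl, ⟨-, h0⟩, hj, hk⟩
    exact ⟨⟨h0, hj⟩, rfl, hk⟩

lemma chains_zero (a k : ℕ) : chains 0 a k = if a = k then {fun _ => a} else ∅ := by
  ext j
  have hj : j = (fun _ => a) ↔ j 0 = a := by
    rw [funext_iff, Fin.forall_fin_one]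
  have hanti : Antitone j := fun s t _ => by rw [Fin.eq_zero s, Fin.eq_zero t]
  simp only [mem_chains, Fin.last_zero, hanti, true_and]
  split_ifs with h
  · rw [mem_singleton, hj, ← h, and_self]
  · simp only [notMem_empty, iff_false, not_and]
    exact fun h0 hk => h (h0 ▸ hk)

lemma sum_chains_succ {M : Type*} [AddCommMonoid M] (n a k : ℕ) (F : (Fin (n + 2) → ℕ) → M) :
    ∑ j ∈ chains (n + 1) a k, F j =
      ∑ m ∈ Icc k a, ∑ j ∈ chains n m k, F (Fin.cons a j) := by
  rw [sum_sigma']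
  refine sum_nbij' (fun j => ⟨Fin.tail j 0, Fin.tail j⟩) (fun x => Fin.cons a x.2) ?_ ?_ ?_ ?_ ?_
  · intro j hj
    rw [← Fin.cons_self_tail j, cons_mem_chains] at hj
    exact mem_sigma.2 hj.2
  · rintro ⟨m, j⟩ hx
    obtain ⟨hm, hj⟩ := mem_sigma.1 hx
    obtain rfl : j 0 = m := (mem_chains.1 hj).2.1
    exact cons_mem_chains.2 ⟨rfl, hm, hj⟩
  · intro j hj
    rw [← (mem_chains.1 hj).2.1, Fin.cons_self_tail]
  · rintro ⟨m, j⟩ hx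
    obtain rfl : j 0 = m := (mem_chains.1 (mem_sigma.1 hx).2).2.1
    rfl
  · intro j hj
    rw [← (mem_chains.1 hj).2.1, Fin.cons_self_tail]

lemma sum_chains_prod {K : Type*} [CommSemiring K] {n : ℕ} (g : Fin n → ℕ → K) {a k : ℕ}
    (hk : k ≤ a) :
    ∑ j ∈ chains n a k, ∏ s, g s (j s.castSucc - j s.succ) =
      PowerSeries.coeff (a - k) (∏ s, PowerSeries.mk (g s)) := by
  induction n generalizing a with
  | zero =>
    rw [chains_zero, univ_eq_empty, prod_empty, PowerSeries.coeff_one]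
    split_ifs <;> first | omega | simp
  | succ n ih =>
    calc ∑ j ∈ chains (n + 1) a k, ∏ s, g s (j s.castSucc - j s.succ)
        = ∑ m ∈ Icc k a, g 0 (a - m) *
            PowerSeries.coeff (m - k) (∏ s : Fin n, PowerSeries.mk (g s.succ)) := by
          rw [sum_chains_succ]
          refine sum_congr rfl fun m hm => ?_
          rw [← ih (fun s => g s.succ) (mem_Icc.1 hm).1, mul_sum]
          refine sum_congr rfl fun j hj => ?_
          rw [Fin.prod_univ_succ]
          simp only [← Fin.succ_castSucc, Fin.cons_succ, Fin.castSucc_zero, Fin.cons_zero,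
            (mem_chains.1 hj).2.1]
      _ = ∑ x ∈ antidiagonal (a - k), PowerSeries.coeff x.1 (PowerSeries.mk (g 0)) *
            PowerSeries.coeff x.2 (∏ s : Fin n, PowerSeries.mk (g s.succ)) := by
          refine sum_nbij' (fun m => (a - m, m - k)) (fun x => k + x.2) ?_ ?_ ?_ ?_ ?_ <;>
            simp only [mem_Icc, HasAntidiagonal.mem_antidiagonal, PowerSeries.coeff_mk,
              Prod.forall, Prod.mk.injEq] <;> grind
      _ = PowerSeries.coeff (a - k) (∏ s, PowerSeries.mk (g s)) := by
          rw [Fin.prod_univ_succ, PowerSeries.coeff_mul]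

end Chains

section PartialFractions

open Finset Polynomial

open scoped PowerSeries

variable {K ι : Type*} [Field K]

lemma X_pow_dvd_trunc_inv_mul_sub_one {p : K[X]} (hp : p.coeff 0 ≠ 0) (m : ℕ) :
    X ^ m ∣ PowerSeries.trunc m (p : K⟦X⟧)⁻¹ * p - 1 := by
  have hinv : (p : K⟦X⟧)⁻¹ * p = 1 :=
    PowerSeries.inv_mul_cancel _ (by rwa [Polynomial.constantCoeff_coe])
  have htrunc : PowerSeries.trunc m ((PowerSeries.trunc m (p : K⟦X⟧)⁻¹ * p : K[X]) : K⟦X⟧) =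
      PowerSeries.trunc m 1 := by
    rw [Polynomial.coe_mul, PowerSeries.trunc_trunc_mul, hinv]
  refine X_pow_dvd_iff.2 fun d hd => ?_
  have hcoeff := congrArg (coeff · d) htrunc
  simp only [PowerSeries.coeff_trunc, if_pos hd, Polynomial.coeff_coe] at hcoeff
  rw [coeff_sub, hcoeff, ← Polynomial.coe_one, Polynomial.coeff_coe, sub_self]

lemma mk_choose_mul_X_sub_C_pow_eq_one {δ : K} (hδ : δ ≠ 0) {a : ℕ} (ha : 0 < a) :
    (PowerSeries.mk fun m => (-1) ^ a * (((a - 1 + m).choose (a - 1) : K) * (δ ^ (m + a))⁻¹)) *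
      (PowerSeries.X - PowerSeries.C δ) ^ a = 1 := by
  set G : K⟦X⟧ := PowerSeries.mk fun m => ((a - 1 + m).choose (a - 1) : K)
  have hG : G * (1 - PowerSeries.X) ^ a = 1 := by
    have h := (PowerSeries.invOneSubPow K a).val_inv
    rwa [PowerSeries.invOneSubPow_inv_eq_one_sub_pow,
      PowerSeries.invOneSubPow_val_eq_mk_sub_one_add_choose_of_pos _ _ ha] at h
  have hlin : PowerSeries.X - PowerSeries.C δ =
      PowerSeries.C (-δ) * PowerSeries.rescale δ⁻¹ (1 - PowerSeries.X : K⟦X⟧) := by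
    rw [map_sub, map_one, PowerSeries.rescale_X, mul_sub, ← mul_assoc, ← map_mul, neg_mul,
      mul_inv_cancel₀ hδ, mul_one, map_neg, map_neg, map_one]
    ring
  have hmk : (PowerSeries.mk fun m =>
        (-1) ^ a * (((a - 1 + m).choose (a - 1) : K) * (δ ^ (m + a))⁻¹)) =
      PowerSeries.C ((-δ)⁻¹ ^ a) * PowerSeries.rescale δ⁻¹ G := by
    ext m
    rw [PowerSeries.coeff_C_mul, PowerSeries.coeff_rescale, PowerSeries.coeff_mk,
      PowerSeries.coeff_mk, inv_neg, neg_pow δ⁻¹, ← inv_pow]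
    ring
  rw [hmk, hlin, mul_pow, mul_mul_mul_comm, ← map_pow, ← map_mul, ← mul_pow,
    inv_mul_cancel₀ (neg_ne_zero.2 hδ), ← map_pow, ← map_mul, hG, one_pow, map_one, map_one,
    one_mul]

variable [Fintype ι] [DecidableEq ι]

/-- The product of the factors of `∏ w, (X + β w) ^ a w` other than the `i`-th. -/
noncomputable def cofactor (β : ι → K) (a : ι → ℕ) (i : ι) : K[X] :=
  ∏ w ∈ univ.erase i, (X + C (β w)) ^ a w

/-- The Taylor series at the point `-β i` of the reciprocal of `cofactor β a i`. Its first `a i`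
coefficients are the partial fraction coefficients of `∏ w, (X + β w) ^ (-a w)` at the pole
`-β i`. -/
noncomputable def cofactorInv (β : ι → K) (a : ι → ℕ) (i : ι) : K⟦X⟧ :=
  ((taylor (-β i) (cofactor β a i) : K[X]) : K⟦X⟧)⁻¹

lemma taylor_neg_cofactor (β : ι → K) (a : ι → ℕ) (i : ι) :
    taylor (-β i) (cofactor β a i) = ∏ w ∈ univ.erase i, (X - C (β i - β w)) ^ a w := by
  rw [cofactor, ← taylorAlgHom_apply, map_prod]
  refine prod_congr rfl fun w _ => ?_
  rw [map_pow, map_add, taylorAlgHom_apply, taylorAlgHom_apply, taylor_X, taylor_C]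
  simp only [map_neg, map_sub]
  ring

lemma coeff_zero_taylor_neg_cofactor_ne_zero {β : ι → K} (hβ : Function.Injective β)
    (a : ι → ℕ) (i : ι) : (taylor (-β i) (cofactor β a i)).coeff 0 ≠ 0 := by
  rw [taylor_neg_cofactor, coeff_zero_eq_eval_zero, eval_prod]
  refine prod_ne_zero_iff.2 fun w hw => ?_
  rw [eval_pow, eval_sub, eval_X, eval_C, zero_sub]
  exact pow_ne_zero _ (neg_ne_zero.2 (sub_ne_zero.2 (hβ.ne (ne_of_mem_erase hw).symm)))

lemma cofactorInv_eq_prod {β : ι → K} (hβ : Function.Injective β) {a : ι → ℕ}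
    (ha : ∀ i, 0 < a i) (i : ι) :
    cofactorInv β a i = ∏ w ∈ univ.erase i, PowerSeries.mk fun m =>
      (-1) ^ a w * (((a w - 1 + m).choose (a w - 1) : K) * ((β i - β w) ^ (m + a w))⁻¹) := by
  have hconst := coeff_zero_taylor_neg_cofactor_ne_zero hβ a i
  rw [← Polynomial.constantCoeff_coe] at hconst
  rw [cofactorInv, eq_comm, PowerSeries.eq_inv_iff_mul_eq_one hconst, taylor_neg_cofactor,
    ← Polynomial.coeToPowerSeries.ringHom_apply, map_prod, ← prod_mul_distrib]
  refine prod_eq_one fun w hw => ?_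
  have hδ : β i - β w ≠ 0 := sub_ne_zero.2 (hβ.ne (ne_of_mem_erase hw).symm)
  rw [← mk_choose_mul_X_sub_C_pow_eq_one hδ (ha w), map_pow,
    Polynomial.coeToPowerSeries.ringHom_apply, Polynomial.coe_sub, Polynomial.coe_X,
    Polynomial.coe_C]

lemma X_add_C_pow_dvd_taylor_trunc_cofactorInv_mul_sub_one {β : ι → K}
    (hβ : Function.Injective β) (a : ι → ℕ) (i : ι) :
    (X + C (β i)) ^ a i ∣
      taylor (β i) (PowerSeries.trunc (a i) (cofactorInv β a i)) * cofactor β a i - 1 := by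
  have hdvd := map_dvd (taylorAlgHom (β i)) (X_pow_dvd_trunc_inv_mul_sub_one
    (coeff_zero_taylor_neg_cofactor_ne_zero hβ a i) (a i))
  simpa [taylor_taylor, cofactorInv] using hdvd

lemma prod_X_add_C_pow_dvd_sum_sub_one {β : ι → K} (hβ : Function.Injective β) (a : ι → ℕ) :
    ∏ i, (X + C (β i)) ^ a i ∣
      ∑ i, taylor (β i) (PowerSeries.trunc (a i) (cofactorInv β a i)) * cofactor β a i - 1 := by
  refine Finset.prod_dvd_of_coprime (fun i _ w _ hiw => IsCoprime.pow ?_) fun i _ => ?_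
  · have hunit : IsUnit (-β i - -β w) :=
      isUnit_iff_ne_zero.2 (sub_ne_zero.2 (neg_injective.ne (hβ.ne hiw)))
    simpa using isCoprime_X_sub_C_of_isUnit_sub hunit
  · rw [← add_sum_erase univ _ (mem_univ i), add_sub_right_comm]
    refine dvd_add (X_add_C_pow_dvd_taylor_trunc_cofactorInv_mul_sub_one hβ a i)
      (dvd_sum fun w hw => Dvd.dvd.mul_left ?_ _)
    exact dvd_prod_of_mem (fun w => (X + C (β w)) ^ a w)
      (mem_erase.2 ⟨(ne_of_mem_erase hw).symm, mem_univ i⟩)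

lemma degree_taylor_trunc_mul_cofactor_lt (β : ι → K) (a : ι → ℕ) (φ : K⟦X⟧) (i : ι) :
    degree (taylor (β i) (PowerSeries.trunc (a i) φ) * cofactor β a i) <
      degree (∏ w, (X + C (β w)) ^ a w) := by
  have hmonic : (cofactor β a i).Monic :=
    monic_prod_of_monic _ _ fun w _ => (monic_X_add_C _).pow _
  rw [← mul_prod_erase univ (fun w => (X + C (β w)) ^ a w) (mem_univ i), ← cofactor, degree_mul,
    degree_mul, degree_pow, degree_X_add_C, nsmul_one, degree_taylor]
  exact WithBot.add_lt_add_right (degree_ne_bot.2 hmonic.ne_zero) (PowerSeries.degree_trunc_lt _ _)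

/- The left-hand side is `1` modulo each `(X + β i) ^ a i`, and its degree is too small for it to
be anything else. -/
lemma sum_taylor_trunc_cofactorInv_mul_cofactor {β : ι → K} (hβ : Function.Injective β)
    {a : ι → ℕ} (ha : a ≠ 0) :
    ∑ i, taylor (β i) (PowerSeries.trunc (a i) (cofactorInv β a i)) * cofactor β a i = 1 := by
  set D : K[X] := ∏ i, (X + C (β i)) ^ a i with hD
  have hmonic : D.Monic := monic_prod_of_monic _ _ fun w _ => (monic_X_add_C _).pow _
  have hdegD : degree (1 : K[X]) < degree D := by
    obtain ⟨i, hi⟩ := Function.ne_iff.1 ha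
    have hnat : D.natDegree = ∑ w, a w := by
      rw [hD, natDegree_prod_of_monic _ _ fun w _ => (monic_X_add_C _).pow _]
      simp only [natDegree_pow, natDegree_X_add_C, mul_one]
    rw [degree_one, ← natDegree_pos_iff_degree_pos, hnat]
    exact (Nat.pos_of_ne_zero hi).trans_le (single_le_sum_of_canonicallyOrdered (mem_univ i))
  have hdeg : degree (∑ i, taylor (β i) (PowerSeries.trunc (a i) (cofactorInv β a i)) *
      cofactor β a i - 1) < degree D :=
    (degree_sub_le _ _).trans_lt (max_lt ((degree_sum_le _ _).trans_lt ((Finset.sup_lt_iff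
      (bot_lt_iff_ne_bot.2 (degree_ne_bot.2 hmonic.ne_zero))).2 fun i _ =>
        degree_taylor_trunc_mul_cofactor_lt β a _ i)) hdegD)
  exact sub_eq_zero.1 (eq_zero_of_dvd_of_degree_lt (prod_X_add_C_pow_dvd_sum_sub_one hβ a) hdeg)

lemma aeval_taylor_trunc_mul_inv_pow {L : Type*} [Field L] [Algebra K L] (φ : K⟦X⟧) (b : K)
    (n : ℕ) {z : L} (hz : z + algebraMap K L b ≠ 0) :
    aeval z (taylor b (PowerSeries.trunc n φ)) * (z + algebraMap K L b)⁻¹ ^ n =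
      ∑ k ∈ Icc 1 n, algebraMap K L (PowerSeries.coeff (n - k) φ) *
        (z + algebraMap K L b)⁻¹ ^ k := by
  rw [taylor_apply, aeval_comp, map_add, aeval_X, aeval_C, aeval_def,
    PowerSeries.eval₂_trunc_eq_sum_range, sum_mul]
  refine sum_nbij' (fun m => n - m) (fun k => n - k) ?_ ?_ ?_ ?_ fun m hm => ?_
  any_goals intro m hm; simp only [mem_range, mem_Icc] at hm ⊢; omega
  have hm' := mem_range.1 hm
  rw [Nat.sub_sub_self hm'.le, mul_assoc, inv_pow, inv_pow, pow_sub₀ _ hz hm'.le, mul_inv, inv_inv,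
    mul_comm (_ ^ m)]

lemma prod_inv_pow_eq_sum_cofactorInv {L : Type*} [Field L] [Algebra K L] {β : ι → K}
    (hβ : Function.Injective β) {a : ι → ℕ} (ha : a ≠ 0) {z : L}
    (hz : ∀ i, z + algebraMap K L (β i) ≠ 0) :
    ∏ w, (z + algebraMap K L (β w))⁻¹ ^ a w =
      ∑ i, ∑ k ∈ Icc 1 (a i), algebraMap K L (PowerSeries.coeff (a i - k) (cofactorInv β a i)) *
        (z + algebraMap K L (β i))⁻¹ ^ k := by
  have heval := congrArg (aeval z) (sum_taylor_trunc_cofactorInv_mul_cofactor hβ ha)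
  rw [map_sum, map_one] at heval
  rw [← mul_one (∏ w, _), ← heval, mul_sum]
  refine sum_congr rfl fun i _ => ?_
  have hcofactor : (∏ w, (z + algebraMap K L (β w))⁻¹ ^ a w) * aeval z (cofactor β a i) =
      (z + algebraMap K L (β i))⁻¹ ^ a i := by
    rw [← mul_prod_erase univ _ (mem_univ i), cofactor, map_prod, mul_assoc, ← prod_mul_distrib,
      prod_eq_one, mul_one]
    intro w _
    rw [map_pow, map_add, aeval_X, aeval_C, ← mul_pow, inv_mul_cancel₀ (hz w), one_pow]
  rw [← aeval_taylor_trunc_mul_inv_pow _ _ _ (hz i), ← hcofactor, map_mul]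
  ring

end PartialFractions

section Weights

open Finset

lemma prod_erase_eq_prod_succAbove {M : Type*} [CommMonoid M] {n : ℕ} (i : Fin (n + 1))
    (f : Fin (n + 1) → M) : ∏ w ∈ univ.erase i, f w = ∏ s, f (i.succAbove s) := by
  rw [← compl_singleton, ← Fin.image_succAbove_univ,
    prod_image Fin.succAbove_right_injective.injOn]

lemma Xi_eq_coeff {n : ℕ} {i : Fin (n + 1)} {k : ℕ} {a : Fin (n + 1) → ℕ} (ha : ∀ i, 0 < a i)
    {β : Fin (n + 1) → ℝ} (hβ : Function.Injective β) (hk : k ≤ a i) :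
    Xi i k a β =
      (∏ w, β w ^ a w) / β i ^ k * PowerSeries.coeff (a i - k) (cofactorInv β a i) := by
  rw [cofactorInv_eq_prod hβ ha, prod_erase_eq_prod_succAbove, ← sum_chains_prod _ hk, Xi, mul_sum]
  refine sum_congr rfl fun j hj => ?_
  have hsum : (∑ w, a w) - a i = ∑ s, a (i.succAbove s) := by
    rw [Fin.sum_univ_succAbove _ i, Nat.add_sub_cancel_left]
  rw [hsum, ← prod_pow_eq_pow_sum, mul_comm (∏ s : Fin n, (-1 : ℝ) ^ a (i.succAbove s)), mul_assoc,
    ← prod_mul_distrib]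
  refine congrArg _ (prod_congr rfl fun s _ => congrArg _ ?_)
  have hle : j s.succ ≤ j s.castSucc := (mem_chains.1 hj).1 Fin.castSucc_lt_succ.le
  have hw := ha (i.succAbove s)
  rw [Nat.cast_choose ℝ (Nat.le_add_right _ _), Nat.add_sub_cancel_left, ← zpow_natCast, ← zpow_neg,
    show j s.castSucc + a (i.succAbove s) - j s.succ - 1 =
      a (i.succAbove s) - 1 + (j s.castSucc - j s.succ) by omega]
  congr 2
  push_cast [Nat.cast_sub hle]
  ring

lemma prod_div_pow_eq_sum_Xi {n : ℕ} {a : Fin (n + 1) → ℕ} (ha : ∀ i, 0 < a i)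
    {β : Fin (n + 1) → ℝ} (hβ : Function.Injective β) (hβ0 : ∀ i, β i ≠ 0) {z : ℂ}
    (hz : ∀ i, z + β i ≠ 0) :
    ∏ w, ((β w : ℂ) / (z + β w)) ^ a w =
      ∑ i, ∑ k ∈ Icc 1 (a i), (Xi i k a β : ℂ) * ((β i : ℂ) / (z + β i)) ^ k := by
  have ha0 : a ≠ 0 := fun h => (ha 0).ne' (congrFun h 0)
  have hpf := prod_inv_pow_eq_sum_cofactorInv hβ ha0 hz
  simp only [Complex.coe_algebraMap] at hpf
  simp only [div_eq_mul_inv, mul_pow, prod_mul_distrib, hpf, mul_sum]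
  refine sum_congr rfl fun i _ => sum_congr rfl fun k hk => ?_
  have hβi : (β i : ℂ) ^ k ≠ 0 := pow_ne_zero _ (Complex.ofReal_ne_zero.2 (hβ0 i))
  rw [Xi_eq_coeff ha hβ (mem_Icc.1 hk).2]
  push_cast
  field_simp

end Weights

section GammaDistribution

open Filter Set Topology

lemma ofReal_exp_mul_gammaPDF {a r t : ℝ} (hr : 0 < r) (ht : t < r) (x : ℝ) :
    ENNReal.ofReal (Real.exp (t * x)) * gammaPDF a r x =
      ENNReal.ofReal ((r / (r - t)) ^ a) * gammaPDF a (r - t) x := by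
  have hrt : 0 < r - t := sub_pos.2 ht
  rw [gammaPDF, gammaPDF, ← ENNReal.ofReal_mul (Real.exp_pos _).le,
    ← ENNReal.ofReal_mul (by positivity)]
  congr 1
  simp only [gammaPDFReal]
  split_ifs
  · rw [Real.div_rpow hr.le hrt.le, show -((r - t) * x) = t * x + -(r * x) by ring, Real.exp_add]
    field_simp
  · rw [mul_zero, mul_zero]

lemma lintegral_exp_mul_gammaMeasure {a r t : ℝ} (ha : 0 < a) (hr : 0 < r) (ht : t < r) :
    ∫⁻ x, ENNReal.ofReal (Real.exp (t * x)) ∂gammaMeasure a r =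
      ENNReal.ofReal ((r / (r - t)) ^ a) := by
  have hpdf (s : ℝ) : Measurable (gammaPDF a s) := (measurable_gammaPDFReal a s).ennreal_ofReal
  rw [gammaMeasure, lintegral_withDensity_eq_lintegral_mul _ (hpdf r) (by fun_prop)]
  simp only [Pi.mul_apply, mul_comm (gammaPDF a r _), ofReal_exp_mul_gammaPDF hr ht]
  rw [lintegral_const_mul _ (hpdf _), lintegral_gammaPDF_eq_one ha (sub_pos.2 ht), mul_one]

lemma mem_integrableExpSet_gammaMeasure {a r t : ℝ} (ha : 0 < a) (hr : 0 < r) (ht : t < r) :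
    t ∈ integrableExpSet id (gammaMeasure a r) := by
  refine (lintegral_ofReal_ne_top_iff_integrable (by fun_prop)
    (ae_of_all _ fun x => (Real.exp_pos _).le)).1 ?_
  simp only [id_eq, lintegral_exp_mul_gammaMeasure ha hr ht, ne_eq, ENNReal.ofReal_ne_top,
    not_false_eq_true]

lemma mgf_gammaMeasure {a r t : ℝ} (ha : 0 < a) (hr : 0 < r) (ht : t < r) :
    mgf id (gammaMeasure a r) t = (r / (r - t)) ^ a := by
  rw [mgf, integral_eq_lintegral_of_nonneg_ae (ae_of_all _ fun x => (Real.exp_pos _).le)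
    (by fun_prop)]
  simp only [id_eq, lintegral_exp_mul_gammaMeasure ha hr ht]
  exact ENNReal.toReal_ofReal (Real.rpow_nonneg (div_pos hr (sub_pos.2 ht)).le _)

lemma div_sub_mem_slitPlane {r : ℝ} (hr : 0 < r) {z : ℂ} (hz : z.re < r) :
    (r : ℂ) / (r - z) ∈ Complex.slitPlane := by
  have hre : 0 < ((r : ℂ) - z).re := by rwa [Complex.sub_re, Complex.ofReal_re, sub_pos]
  have hrz : (r : ℂ) - z ≠ 0 := fun h => hre.ne' (by rw [h, Complex.zero_re])
  rw [Complex.mem_slitPlane_iff, Complex.div_re, Complex.ofReal_re, Complex.ofReal_im, zero_mul,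
    zero_div, add_zero]
  exact Or.inl (div_pos (mul_pos hr hre) (Complex.normSq_pos.2 hrz))

/- Both sides are analytic on the half-plane `re z < r` and agree on its real points. -/
lemma complexMGF_gammaMeasure {a r : ℝ} (ha : 0 < a) (hr : 0 < r) {z : ℂ} (hz : z.re < r) :
    complexMGF id (gammaMeasure a r) z = ((r : ℂ) / (r - z)) ^ (a : ℂ) := by
  set U : Set ℂ := {z | z.re < r} with hU
  have hinterior : Iio r ⊆ interior (integrableExpSet id (gammaMeasure a r)) :=
    interior_maximal (fun t ht => mem_integrableExpSet_gammaMeasure ha hr ht) isOpen_Iio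
  have hmgf : AnalyticOnNhd ℂ (complexMGF id (gammaMeasure a r)) U :=
    analyticOnNhd_complexMGF.mono fun z hz => hinterior hz
  have hpow : AnalyticOnNhd ℂ (fun z => ((r : ℂ) / (r - z)) ^ (a : ℂ)) U := by
    intro z hz
    have hrz : (r : ℂ) - z ≠ 0 := fun h =>
      (show z.re < r from hz).ne (by simp [← sub_eq_zero.1 h])
    exact (analyticAt_const.div (analyticAt_const.sub analyticAt_id) hrz).cpow analyticAt_const
      (div_sub_mem_slitPlane hr hz)
  have hreal : ∃ᶠ t : ℝ in 𝓝[≠] 0,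
      complexMGF id (gammaMeasure a r) t = ((r : ℂ) / (r - t)) ^ (a : ℂ) := by
    refine (eventually_nhdsWithin_of_eventually_nhds
      ((eventually_lt_nhds hr).mono fun t ht => ?_)).frequently
    rw [complexMGF_ofReal, mgf_gammaMeasure ha hr ht,
      Complex.ofReal_cpow (div_pos hr (sub_pos.2 ht)).le]
    push_cast
    rfl
  have hofReal : Tendsto (fun t : ℝ => (t : ℂ)) (𝓝[≠] 0) (𝓝[≠] 0) := by
    rw [← Complex.ofReal_zero]
    exact Complex.ofRealCLM.hasDerivAt.tendsto_nhdsNE (by simp)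
  exact hmgf.eqOn_of_preconnected_of_frequently_eq hpow
    (convex_halfSpace_re_lt r).isPreconnected (z₀ := 0) (by simpa [hU] using hr)
    (hofReal.frequently hreal) hz

lemma charFun_gammaMeasure {a r : ℝ} (ha : 0 < a) (hr : 0 < r) (t : ℝ) :
    charFun (gammaMeasure a r) t = ((r : ℂ) / (r - t * Complex.I)) ^ (a : ℂ) := by
  rw [← complexMGF_id_mul_I, complexMGF_gammaMeasure ha hr (by simpa using hr)]

lemma measureReal_gammaMeasure_Iic {a r x : ℝ} (ha : 0 < a) (hr : 0 < r) (hx : 0 ≤ x) :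
    (gammaMeasure a r).real (Iic x) = 1 / Real.Gamma a * lowerGamma a (r * x) := by
  have := isProbabilityMeasure_gammaMeasure ha hr
  have hneg : ∀ y ∈ Iic x \ Icc 0 x, gammaPDFReal a r y = 0 := fun y hy =>
    if_neg fun h0 => hy.2 ⟨h0, hy.1⟩
  have hpdf : ∀ y ∈ uIcc 0 x, gammaPDFReal a r y =
      r / Real.Gamma a * ((r * y) ^ (a - 1) * Real.exp (-(r * y))) := by
    intro y hy
    rw [uIcc_of_le hx] at hy
    rw [gammaPDFReal, if_pos hy.1, Real.mul_rpow hr.le hy.1, Real.rpow_sub_one hr.ne']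
    field_simp
  rw [← cdf_eq_real, cdf_gammaMeasure_eq_integral ha hr,
    setIntegral_eq_of_subset_of_forall_sdiff_eq_zero measurableSet_Iic Icc_subset_Iic_self hneg,
    integral_Icc_eq_integral_Ioc, ← intervalIntegral.integral_of_le hx,
    intervalIntegral.integral_congr hpdf, intervalIntegral.integral_const_mul,
    intervalIntegral.integral_comp_mul_left (fun t => t ^ (a - 1) * Real.exp (-t)) hr.ne',
    mul_zero, lowerGamma, smul_eq_mul]
  field_simp

lemma map_withDensity_abs_deriv_mul {s : Set ℝ} {f f' : ℝ → ℝ} {g : ℝ → ENNReal}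
    (hs : MeasurableSet s) (hf : Measurable f)
    (hf' : ∀ x ∈ s, HasDerivWithinAt f (f' x) s x) (hinj : InjOn f s) :
    ((volume.restrict s).withDensity fun x => ENNReal.ofReal |f' x| * g (f x)).map f =
      (volume.restrict (f '' s)).withDensity g := by
  ext t ht
  rw [Measure.map_apply hf ht, withDensity_apply _ (hf ht), withDensity_apply _ ht,
    Measure.restrict_restrict (hf ht), Measure.restrict_restrict ht, ← image_preimage_inter,
    lintegral_image_eq_lintegral_abs_deriv_mul ((hf ht).inter hs)
      (fun x hx => (hf' x hx.2).mono inter_subset_right) (hinj.mono inter_subset_right)]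

lemma ofReal_nakagamiPDFReal {m w c x : ℝ} (hm : 0 < m) (hw : 0 < w) (hc : 0 < c) (hx : 0 < x) :
    ENNReal.ofReal (nakagamiPDFReal m w x) =
      ENNReal.ofReal |2 * c * x| * gammaPDF m (m / (w * c)) (c * x ^ 2) := by
  rw [gammaPDF, ← ENNReal.ofReal_mul (abs_nonneg _), abs_of_pos (by positivity), nakagamiPDFReal,
    gammaPDFReal, if_pos hx.le, if_pos (by positivity)]
  congr 1
  have hpow : (x ^ 2) ^ (m - 1) = x ^ (2 * m - 1) / x := by
    rw [← Real.rpow_natCast, ← Real.rpow_mul hx.le, ← Real.rpow_sub_one hx.ne']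
    congr 1
    push_cast
    ring
  rw [Real.div_rpow hm.le (by positivity), Real.mul_rpow hw.le hc.le,
    Real.mul_rpow hc.le (by positivity), hpow, Real.rpow_sub_one hc.ne',
    show -(m / (w * c) * (c * x ^ 2)) = -(m / w) * x ^ 2 by field_simp]
  field_simp

lemma withDensity_eq_restrict_Ioi {f : ℝ → ENNReal} (hf : ∀ x < 0, f x = 0) :
    volume.withDensity f = (volume.restrict (Ioi 0)).withDensity f := by
  have hIci : (Ici 0).indicator f = f := indicator_eq_self.2 fun x hx =>
    not_lt.1 fun h => hx (hf x h)
  rw [restrict_Ioi_eq_restrict_Ici, ← withDensity_indicator measurableSet_Ici, hIci]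

lemma hasLaw_mul_sq_nakagamiMeasure {m w c : ℝ} (hm : 0 < m) (hw : 0 < w) (hc : 0 < c) :
    HasLaw (fun x => c * x ^ 2) (gammaMeasure m (m / (w * c))) (nakagamiMeasure m w) := by
  refine ⟨by fun_prop, ?_⟩
  have himage : (fun x : ℝ => c * x ^ 2) '' Ioi 0 = Ioi 0 := by
    have hpos (x : ℝ) (hx : 0 < x) : 0 < c * x ^ 2 := by positivity
    refine Subset.antisymm (image_subset_iff.2 hpos) fun y (hy : 0 < y) => ?_
    refine ⟨√(y / c), mem_Ioi.2 (by positivity), ?_⟩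
    simp only [Real.sq_sqrt (div_pos hy hc).le, mul_div_cancel₀ y hc.ne']
  have hinj : InjOn (fun x : ℝ => c * x ^ 2) (Ioi 0) := fun x hx y hy hxy =>
    (pow_left_inj₀ (le_of_lt hx) (le_of_lt hy) two_ne_zero).1 (mul_left_cancel₀ hc.ne' hxy)
  have hderiv : ∀ x ∈ Ioi (0 : ℝ), HasDerivWithinAt (fun x : ℝ => c * x ^ 2) (2 * c * x)
      (Ioi 0) x :=
    fun x _ => (((hasDerivAt_pow 2 x).const_mul c).congr_deriv (by ring)).hasDerivWithinAt
  have hnakagami : ∀ x < 0, ENNReal.ofReal (nakagamiPDFReal m w x) = 0 := fun x hx => by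
    rw [nakagamiPDFReal, if_neg hx.not_ge, ENNReal.ofReal_zero]
  have hmap := map_withDensity_abs_deriv_mul (g := gammaPDF m (m / (w * c))) measurableSet_Ioi
    (by fun_prop) hderiv hinj
  rw [himage] at hmap
  rw [nakagamiMeasure, withDensity_eq_restrict_Ioi hnakagami, gammaMeasure,
    withDensity_eq_restrict_Ioi (f := gammaPDF m (m / (w * c))) fun x => gammaPDF_of_neg, ← hmap]
  congr 1
  refine withDensity_congr_ae ((ae_restrict_iff' measurableSet_Ioi).2 (ae_of_all _ fun x hx => ?_))
  exact ofReal_nakagamiPDFReal hm hw hc hx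

end GammaDistribution

section SignedMixtures

variable {ι E : Type*} [Fintype ι] [MeasurableSpace E]

lemma measureReal_sum_nnreal_smul (ν : ι → Measure E) [∀ i, IsFiniteMeasure (ν i)]
    (d : ι → NNReal) (s : Set E) :
    (∑ i, d i • ν i).real s = ∑ i, (d i : ℝ) * (ν i).real s := by
  rw [measureReal_def, Measure.finsetSum_apply, ENNReal.toReal_sum fun i _ => measure_ne_top _ _]
  exact Finset.sum_congr rfl fun i _ => by rw [← measureReal_def, measureReal_nnreal_smul_apply]

variable [NormedAddCommGroup E] [InnerProductSpace ℝ E] [BorelSpace E]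

lemma charFun_add_measure (μ ν : Measure E) [IsFiniteMeasure μ] [IsFiniteMeasure ν] (t : E) :
    charFun (μ + ν) t = charFun μ t + charFun ν t := by
  simp only [charFun_eq_integral_innerProbChar]
  exact integral_add_measure (BoundedContinuousFunction.integrable _ _)
    (BoundedContinuousFunction.integrable _ _)

lemma charFun_sum_nnreal_smul (ν : ι → Measure E) [∀ i, IsFiniteMeasure (ν i)] (d : ι → NNReal)
    (t : E) : charFun (∑ i, d i • ν i) t = ∑ i, ((d i : ℝ) : ℂ) * charFun (ν i) t := by
  simp only [charFun_eq_integral_innerProbChar]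
  rw [integral_finsetSum_measure fun i _ => BoundedContinuousFunction.integrable _ _]
  refine Finset.sum_congr rfl fun i _ => ?_
  rw [integral_smul_nnreal_measure, NNReal.smul_def, Complex.real_smul]

/- Moving the terms with negative coefficients to the other side turns the signed identity into an
identity between finite measures. -/
lemma measureReal_eq_sum_of_charFun_eq_sum [CompleteSpace E] [SecondCountableTopology E]
    {μ : Measure E} [IsFiniteMeasure μ] {ν : ι → Measure E} [∀ i, IsFiniteMeasure (ν i)]
    {c : ι → ℝ}
    (h : ∀ t, charFun μ t = ∑ i, (c i : ℂ) * charFun (ν i) t) (s : Set E) :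
    μ.real s = ∑ i, c i * (ν i).real s := by
  have hsplit (i : ι) : c i + (-c i).toNNReal = (c i).toNNReal := by
    rw [Real.coe_toNNReal', Real.coe_toNNReal', ← max_add_add_left, add_zero, add_neg_cancel,
      max_comm]
  have hmeasure : μ + ∑ i, (-c i).toNNReal • ν i = ∑ i, (c i).toNNReal • ν i := by
    refine Measure.ext_of_charFun (funext fun t => ?_)
    rw [charFun_add_measure, charFun_sum_nnreal_smul, charFun_sum_nnreal_smul, h,
      ← Finset.sum_add_distrib]
    exact Finset.sum_congr rfl fun i _ => by rw [← hsplit, ← add_mul, Complex.ofReal_add]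
  have hreal : (μ + ∑ i, (-c i).toNNReal • ν i).real s = (∑ i, (c i).toNNReal • ν i).real s := by
    rw [hmeasure]
  rw [measureReal_add_apply, measureReal_sum_nnreal_smul, measureReal_sum_nnreal_smul] at hreal
  simp only [← hsplit, add_mul, Finset.sum_add_distrib] at hreal
  exact add_right_cancel hreal

end SignedMixtures

section SumsOfGammas

open Finset

variable {Ω ι : Type*} [MeasurableSpace Ω] {μ : Measure Ω} [Fintype ι]

lemma charFun_map_sum_gamma {X : ι → Ω → ℝ} {a β : ι → ℝ} (ha : ∀ i, 0 < a i)
    (hβ : ∀ i, 0 < β i) (hX : ∀ i, HasLaw (X i) (gammaMeasure (a i) (β i)) μ)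
    (hindep : iIndepFun X μ) (t : ℝ) :
    charFun (μ.map fun ω => ∑ i, X i ω) t =
      ∏ i, ((β i : ℂ) / (β i - t * Complex.I)) ^ (a i : ℂ) := by
  rw [hindep.charFun_map_fun_sum_eq_prod fun i => (hX i).aemeasurable, Finset.prod_apply]
  exact prod_congr rfl fun i _ => by rw [(hX i).map_eq, charFun_gammaMeasure (ha i) (hβ i)]

lemma hasLaw_sum_gamma [Nonempty ι] {X : ι → Ω → ℝ} {a : ι → ℝ} {r : ℝ} (ha : ∀ i, 0 < a i)
    (hr : 0 < r) (hX : ∀ i, HasLaw (X i) (gammaMeasure (a i) r) μ) (hindep : iIndepFun X μ) :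
    HasLaw (fun ω => ∑ i, X i ω) (gammaMeasure (∑ i, a i) r) μ := by
  have hmeas : AEMeasurable (fun ω => ∑ i, X i ω) μ :=
    aemeasurable_fun_sum _ fun i _ => (hX i).aemeasurable
  have hpos : 0 < ∑ i, a i := sum_pos (fun i _ => ha i) univ_nonempty
  have := hindep.isProbabilityMeasure
  have := Measure.isProbabilityMeasure_map hmeas
  have := isProbabilityMeasure_gammaMeasure hpos hr
  refine ⟨hmeas, Measure.ext_of_charFun (funext fun t => ?_)⟩
  have hbase : (r : ℂ) / (r - t * Complex.I) ≠ 0 :=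
    Complex.slitPlane_ne_zero (div_sub_mem_slitPlane hr (by simpa using hr))
  rw [charFun_map_sum_gamma ha (fun _ => hr) hX hindep, charFun_gammaMeasure hpos hr,
    Complex.ofReal_sum]
  simp only [Complex.cpow_def_of_ne_zero hbase, mul_sum, Complex.exp_sum]

lemma measureReal_map_sum_gamma {n : ℕ} {X : Fin (n + 1) → Ω → ℝ} {a : Fin (n + 1) → ℕ}
    {β : Fin (n + 1) → ℝ} (ha : ∀ i, 0 < a i) (hβ : ∀ i, 0 < β i) (hinj : Function.Injective β)
    (hX : ∀ i, HasLaw (X i) (gammaMeasure (a i) (β i)) μ) (hindep : iIndepFun X μ) (s : Set ℝ) :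
    (μ.map fun ω => ∑ i, X i ω).real s =
      ∑ i, ∑ k ∈ Icc 1 (a i), Xi i k a β * (gammaMeasure k (β i)).real s := by
  have hmeas : AEMeasurable (fun ω => ∑ i, X i ω) μ :=
    aemeasurable_fun_sum _ fun i _ => (hX i).aemeasurable
  have := hindep.isProbabilityMeasure
  have := Measure.isProbabilityMeasure_map hmeas
  have hk {i : Fin (n + 1)} (k : Icc 1 (a i)) : (0 : ℝ) < (k : ℕ) :=
    Nat.cast_pos.2 (mem_Icc.1 k.2).1
  have (x : Σ i, Icc 1 (a i)) : IsFiniteMeasure (gammaMeasure (x.2 : ℕ) (β x.1)) :=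
    have := isProbabilityMeasure_gammaMeasure (hk x.2) (hβ x.1)
    inferInstance
  have hcharFun (t : ℝ) : charFun (μ.map fun ω => ∑ i, X i ω) t =
      ∑ x : Σ i, Icc 1 (a i), (Xi x.1 x.2 a β : ℂ) *
        charFun (gammaMeasure (x.2 : ℕ) (β x.1)) t := by
    have hz (i) : -(t * Complex.I) + β i ≠ 0 := fun h =>
      (hβ i).ne' (by simpa using congrArg Complex.re h)
    have hpf := prod_div_pow_eq_sum_Xi ha hinj (fun i => (hβ i).ne') hz
    rw [charFun_map_sum_gamma (fun i => Nat.cast_pos.2 (ha i)) hβ hX hindep, Fintype.sum_sigma]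
    simp only [charFun_gammaMeasure (hk _) (hβ _), Complex.ofReal_natCast, Complex.cpow_natCast,
      sub_eq_neg_add, hpf]
    exact sum_congr rfl fun i _ => (sum_coe_sort (Icc 1 (a i)) fun k => _).symm
  rw [measureReal_eq_sum_of_charFun_eq_sum hcharFun, Fintype.sum_sigma]
  exact sum_congr rfl fun i _ =>
    sum_coe_sort (Icc 1 (a i)) fun k => Xi i k a β * (gammaMeasure k (β i)).real s

end SumsOfGammas

section HarvestedPower

open Set

lemma harvestedPower_zero (Ps A B : ℝ) : harvestedPower Ps A B 0 = 0 := by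
  rw [harvestedPower, show -A * (0 - B) = A * B by ring]
  field_simp
  ring

lemma harvestedPower_mono {Ps A : ℝ} (hPs : 0 < Ps) (hA : 0 < A) (B : ℝ) :
    Monotone (harvestedPower Ps A B) := by
  intro x y hxy
  have hexp : Real.exp (-A * (y - B)) ≤ Real.exp (-A * (x - B)) :=
    Real.exp_le_exp.2 (by nlinarith)
  unfold harvestedPower
  gcongr

lemma harvestedPower_lt {Ps : ℝ} (hPs : 0 < Ps) (A B x : ℝ) : harvestedPower Ps A B x < Ps := by
  have hx := Real.exp_pos (-A * (x - B))
  calc harvestedPower Ps A B x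
      < Ps * (1 + Real.exp (A * B)) / (Real.exp (A * B) * 1) - Ps / Real.exp (A * B) := by
        unfold harvestedPower
        gcongr
        linarith
    _ = Ps := by field_simp; ring

lemma harvestedPower_le_iff {Ps A : ℝ} (hA : 0 < A) (B : ℝ) {q : ℝ} (hq : q ∈ Ico 0 Ps) (x : ℝ) :
    harvestedPower Ps A B x ≤ q ↔ x ≤ -(logTerm Ps A B q / A) := by
  have hPs : 0 < Ps := hq.1.trans_lt hq.2
  set E := Real.exp (A * B) with hE_def
  have hE : 0 < E := Real.exp_pos _
  have hd : 0 < q + Ps / E := add_pos_of_nonneg_of_pos hq.1 (by positivity)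
  have hlog : 0 < Ps * (1 + E) / (E * (q + Ps / E)) - 1 := by
    rw [sub_pos, one_lt_div (by positivity), mul_add, mul_div_cancel₀ _ hE.ne']
    nlinarith [hq.2]
  have hsolve : Ps * (1 + E) / (E * (1 + Real.exp (-A * (x - B)))) ≤ q + Ps / E ↔
      Ps * (1 + E) / (E * (q + Ps / E)) - 1 ≤ Real.exp (-A * (x - B)) := by
    rw [sub_le_iff_le_add, div_le_iff₀ (by positivity), div_le_iff₀ (by positivity)]
    exact iff_of_eq (congrArg _ (by ring))
  rw [harvestedPower, logTerm, sub_le_iff_le_add, ← hE_def, hsolve, ← Real.log_le_iff_le_exp hlog,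
    ← neg_div, le_div_iff₀ hA]
  constructor <;> intro h <;> linarith

lemma neg_logTerm_div_nonneg {Ps A : ℝ} (hA : 0 < A) (B : ℝ) {q : ℝ} (hq : q ∈ Ico 0 Ps) :
    0 ≤ -(logTerm Ps A B q / A) :=
  (harvestedPower_le_iff hA B hq 0).1 ((harvestedPower_zero Ps A B).trans_le hq.1)

variable {ν : Measure ℝ} [IsProbabilityMeasure ν] {Ps A : ℝ}

lemma cdf_map_harvestedPower (hPs : 0 < Ps) (hA : 0 < A) (B q : ℝ) :
    cdf (ν.map (harvestedPower Ps A B)) q = ν.real {x | harvestedPower Ps A B x ≤ q} := by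
  have hmeas := (harvestedPower_mono hPs hA B).measurable
  have := Measure.isProbabilityMeasure_map (μ := ν) hmeas.aemeasurable
  rw [cdf_eq_real, map_measureReal_apply hmeas measurableSet_Iic]
  rfl

lemma cdf_map_harvestedPower_of_neg (hPs : 0 < Ps) (hA : 0 < A) (B : ℝ)
    (hν : ∀ᵐ x ∂ν, 0 ≤ x) {q : ℝ} (hq : q < 0) :
    cdf (ν.map (harvestedPower Ps A B)) q = 0 := by
  rw [cdf_map_harvestedPower hPs hA, measureReal_eq_zero_iff]
  refine measure_mono_null (t := {x | ¬0 ≤ x})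
    (fun x (hx : harvestedPower Ps A B x ≤ q) (h0 : 0 ≤ x) => ?_) (ae_iff.1 hν)
  have hQ := harvestedPower_mono hPs hA B h0
  rw [harvestedPower_zero] at hQ
  exact (hx.trans_lt hq).not_ge hQ

lemma cdf_map_harvestedPower_of_le (hPs : 0 < Ps) (hA : 0 < A) (B : ℝ) {q : ℝ} (hq : Ps ≤ q) :
    cdf (ν.map (harvestedPower Ps A B)) q = 1 := by
  have huniv : {x | harvestedPower Ps A B x ≤ q} = univ :=
    eq_univ_of_forall fun x => (harvestedPower_lt hPs A B x).le.trans hq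
  rw [cdf_map_harvestedPower hPs hA, huniv, probReal_univ]

lemma cdf_map_harvestedPower_of_mem_Ico (hA : 0 < A) (B : ℝ) {q : ℝ} (hq : q ∈ Ico 0 Ps) :
    cdf (ν.map (harvestedPower Ps A B)) q = ν.real (Iic (-(logTerm Ps A B q / A))) := by
  rw [cdf_map_harvestedPower (hq.1.trans_lt hq.2) hA]
  exact congrArg _ (Set.ext fun x => harvestedPower_le_iff hA B hq x)

end HarvestedPower

section ReceivedPower

open Set

variable {Ω : Type*} [MeasurableSpace Ω] {μ : Measure Ω}

lemma receivedPower_nonneg {L : ℕ} {l p : Fin L → ℝ} (hl : ∀ i, 0 ≤ l i) (hp : ∀ i, 0 ≤ p i)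
    (h : Fin L → ℂ) : 0 ≤ receivedPower l p h :=
  Finset.sum_nonneg fun i _ => mul_nonneg (mul_nonneg (hl i) (hp i)) (sq_nonneg _)

lemma hasLaw_mul_sq_gammaMeasure {X : Ω → ℝ} {m b c : ℝ} (hm : 0 < m) (hb : 0 < b) (hc : 0 < c)
    (hX : HasLaw X (nakagamiMeasure m (m / b)) μ) :
    HasLaw (fun ω => c * X ω ^ 2) (gammaMeasure m (b / c)) μ := by
  have hrate : m / (m / b * c) = b / c := by field_simp
  rw [← hrate]
  exact (hasLaw_mul_sq_nakagamiMeasure hm (div_pos hm hb) hc).fun_comp hX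

lemma measureReal_gammaMeasure_Iic_neg_logTerm {s b l p Ps A q : ℝ} (hs : 0 < s)
    (hr : 0 < b / (l * p)) (hA : 0 < A) (B : ℝ) (hq : q ∈ Ico 0 Ps) :
    (gammaMeasure s (b / (l * p))).real (Iic (-(logTerm Ps A B q / A))) =
      1 / Real.Gamma s * lowerGamma s (-(b / (A * l * p)) * logTerm Ps A B q) := by
  rw [measureReal_gammaMeasure_Iic hs hr (neg_logTerm_div_nonneg hA B hq)]
  congr 2
  field_simp

end ReceivedPower

end MISO

open MISO in
theorem mainTheorem5_general {Ω : Type*} [MeasurableSpace Ω] (μ : Measure Ω)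
    (n : ℕ) (α b l p : Fin (n + 1) → ℝ) (Ps A B : ℝ)
    (hα : ∀ i, 0 < α i) (hb : ∀ i, 0 < b i) (hl : ∀ i, 0 < l i) (hp : ∀ i, 0 < p i)
    (hPs : 0 < Ps) (hA : 0 < A) (h : Fin (n + 1) → Ω → ℂ)
    (hlaw : ∀ i, HasLaw (fun ω => ‖h i ω‖) (nakagamiMeasure (α i) (α i / b i)) μ)
    (hindep : iIndepFun (fun i ω => ‖h i ω‖) μ)
    (Q : Ω → ℝ)
    (hQ : ∀ ω, Q ω = harvestedPower Ps A B (receivedPower l p fun i => h i ω)) :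
    (∀ i, HasLaw (fun ω => l i * p i * ‖h i ω‖ ^ 2)
      (gammaMeasure (α i) (b i / (l i * p i))) μ) ∧
    iIndepFun (fun i ω => l i * p i * ‖h i ω‖ ^ 2) μ ∧
    AEMeasurable Q μ ∧
    (∀ q < 0, cdf (μ.map Q) q = 0) ∧
    (∀ q, Ps ≤ q → cdf (μ.map Q) q = 1) ∧
    ((∀ i j, b i / (l i * p i) = b j / (l j * p j)) →
      ∀ i, ∀ q ∈ Set.Ico 0 Ps,
        cdf (μ.map Q) q = 1 / Real.Gamma (∑ w, α w) *
          lowerGamma (∑ w, α w) (-(b i / (A * l i * p i)) * logTerm Ps A B q)) ∧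
    (∀ a : Fin (n + 1) → ℕ, (∀ i, α i = a i) →
      (∀ i j, i ≠ j → b i / (l i * p i) ≠ b j / (l j * p j)) →
      ∀ q ∈ Set.Ico 0 Ps,
        cdf (μ.map Q) q = ∑ i, ∑ k ∈ Finset.Icc 1 (a i),
          1 / Real.Gamma (k : ℝ) *
            lowerGamma (k : ℝ) (-(b i / (A * l i * p i)) * logTerm Ps A B q) *
            Xi i k a (fun w => b w / (l w * p w))) := by
  have hlp (i) : 0 < l i * p i := mul_pos (hl i) (hp i)
  have hrate (i) : 0 < b i / (l i * p i) := div_pos (hb i) (hlp i)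
  have hgamma (i) := hasLaw_mul_sq_gammaMeasure (hα i) (hb i) (hlp i) (hlaw i)
  have hindep' : iIndepFun (fun i ω => l i * p i * ‖h i ω‖ ^ 2) μ :=
    hindep.comp (fun i x => l i * p i * x ^ 2) fun i => by fun_prop
  let S (ω : Ω) : ℝ := receivedPower l p fun i => h i ω
  have hS : AEMeasurable S μ := Finset.aemeasurable_fun_sum _ fun i _ => (hgamma i).aemeasurable
  have hmeas := (harvestedPower_mono hPs hA B).measurable
  obtain rfl : Q = harvestedPower Ps A B ∘ S := funext hQ
  rw [← AEMeasurable.map_map_of_aemeasurable hmeas.aemeasurable hS]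
  have := hindep.isProbabilityMeasure
  have := Measure.isProbabilityMeasure_map hS
  refine ⟨hgamma, hindep', hmeas.comp_aemeasurable hS, fun q hq => ?_,
    fun q => cdf_map_harvestedPower_of_le hPs hA B, fun heq i q hq => ?_,
    fun a ha hne q hq => ?_⟩
  · have hnonneg (ω) : 0 ≤ S ω :=
      receivedPower_nonneg (fun i => (hl i).le) (fun i => (hp i).le) _
    exact cdf_map_harvestedPower_of_neg hPs hA B
      ((ae_map_iff hS measurableSet_Ici).2 (ae_of_all _ hnonneg)) hq
  · have hlawS := hasLaw_sum_gamma hα (hrate i) (fun j => heq i j ▸ hgamma j) hindep'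
    have hsum : 0 < ∑ w, α w := Finset.sum_pos (fun i _ => hα i) Finset.univ_nonempty
    rw [cdf_map_harvestedPower_of_mem_Ico hA B hq,
      ← measureReal_gammaMeasure_Iic_neg_logTerm hsum (hrate i) hA B hq, ← hlawS.map_eq]
    rfl
  · obtain rfl : α = fun i => (a i : ℝ) := funext ha
    have hinj : Function.Injective fun i => b i / (l i * p i) := fun i j => not_imp_not.1 (hne i j)
    rw [cdf_map_harvestedPower_of_mem_Ico hA B hq]
    refine (measureReal_map_sum_gamma (fun i => Nat.cast_pos.1 (hα i)) hrate hinj hgamma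
      hindep' _).trans (Finset.sum_congr rfl fun i _ => Finset.sum_congr rfl fun k hk => ?_)
    rw [measureReal_gammaMeasure_Iic_neg_logTerm (Nat.cast_pos.2 (Finset.mem_Icc.1 hk).1)
      (hrate i) hA B hq, mul_comm]

theorem mainTheorem5 {Ω : Type*} [MeasurableSpace Ω] (μ : Measure Ω) [IsProbabilityMeasure μ]
    (n : ℕ) (a : Fin (n + 1) → ℕ) (b l p : Fin (n + 1) → ℝ) (Ps A B : ℝ)
    (ha : ∀ i, 0 < a i) (hb : ∀ i, 0 < b i) (hl : ∀ i, 0 < l i) (hp : ∀ i, 0 < p i)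
    (hPs : 0 < Ps) (hA : 0 < A) (hB : 0 < B)
    (h : Fin (n + 1) → Ω → ℂ)
    (hlaw : ∀ i, HasLaw (fun ω => ‖h i ω‖) (MISO.nakagamiMeasure (a i) (a i / b i)) μ)
    (hindep : iIndepFun (fun i ω => ‖h i ω‖) μ)
    (Q : Ω → ℝ)
    (hQ : ∀ ω, Q ω = MISO.harvestedPower Ps A B (MISO.receivedPower l p fun i => h i ω)) :
    -- the received power is a sum of independent gamma random variables
    (∀ i, HasLaw (fun ω => l i * p i * ‖h i ω‖ ^ 2)
      (gammaMeasure (a i) (b i / (l i * p i))) μ) ∧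
    iIndepFun (fun i ω => l i * p i * ‖h i ω‖ ^ 2) μ ∧
    -- the harvested power is a random variable, and its distribution function outside `[0, Ps)`
    AEMeasurable Q μ ∧
    (∀ q < 0, cdf (μ.map Q) q = 0) ∧
    (∀ q, Ps ≤ q → cdf (μ.map Q) q = 1) ∧
    -- all `b i / (l i * p i)` equal
    ((∀ i j, b i / (l i * p i) = b j / (l j * p j)) →
      ∀ i, ∀ q ∈ Set.Ico 0 Ps,
        cdf (μ.map Q) q = 1 / Real.Gamma (∑ w, (a w : ℝ)) *
          MISO.lowerGamma (∑ w, (a w : ℝ))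
            (-(b i / (A * l i * p i)) * MISO.logTerm Ps A B q)) ∧
    -- the `b i / (l i * p i)` pairwise distinct
    ((∀ i j, i ≠ j → b i / (l i * p i) ≠ b j / (l j * p j)) →
      ∀ q ∈ Set.Ico 0 Ps,
        cdf (μ.map Q) q = ∑ i, ∑ k ∈ Finset.Icc 1 (a i),
          1 / Real.Gamma (k : ℝ) *
            MISO.lowerGamma (k : ℝ)
              (-(b i / (A * l i * p i)) * MISO.logTerm Ps A B q) *
            MISO.Xi i k a (fun w => b w / (l w * p w))) := by
  obtain ⟨hgamma, hindep', hQmeas, hneg, hle, hequal, hdistinct⟩ := mainTheorem5_general μ n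
    (fun i => a i) b l p Ps A B (fun i => Nat.cast_pos.2 (ha i)) hb hl hp hPs hA h hlaw hindep Q hQ
  exact ⟨hgamma, hindep', hQmeas, hneg, hle, hequal, hdistinct a fun _ => rfl⟩
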